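/- **Definitions.** Write $\mathbb N=\{1,2,\dots\}$, and let $\mathrm{Geo}(1-p)$, $p\in[0,1]$, be the law on $\mathbb N\cup\{\infty\}$ with $\mathbb P(\tau>n)=p^n$ for all $n\ge 0$. A law on $\mathbb N^d$ is *narrow-sense geometric* if it is the law of $(\min\{E_I: k\in I\})_{k=1}^d$ for independent $E_I\sim\mathrm{Geo}(1-p_I)$, $\emptyset\ne I\subseteq\{1,\dots,d\}$, with $p_I\in[0,1]$ and $\prod_{I\ni k}p_I<1$ for each $k$. It is *wide-sense geometric* if it is the law of $(\min\{\widetilde E_I: k\in I\})_{k=1}^d$, where an experiment with outcomes $I\subseteq\{1,\dots,d\}$ of probabilities $\tilde p_I$ (with $\sum_I\tilde p_I=1$ and $\sum_{I\not\ni k}\tilde p_I<1$ for each $k$) is repeated independently, and $\widetilde E_I$ is the number of the first trial with outcome $I$. A wide-sense (resp. narrow-sense) geometric law on $\mathbb N^d$ is *extendible* if it is the law of the first $d$ members of an infinite exchangeable sequence all of whose finite blocks have wide-sense (resp. narrow-sense) geometric laws. A law on $[0,\infty]$ is *infinitely divisible* if for every $n\ge2$ it is the law of a sum of $n$ i.i.d.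 $[0,\infty]$-valued random variables. **Theorem.** Let $X_1,X_2,\dots$ be i.i.d. $[0,\infty]$-valued random variables with $\mathbb P(X_1>0)>0$, and let $E_1,E_2,\dots$ be i.i.d. $\mathrm{Exp}(1)$ random variables, the sequence $(E_k)$ being independent of the sequence $(X_k)$. Let $\tau_k=\min\{n\in\mathbb N: X_1+\dots+X_n\ge E_k\}$, $k\in\mathbb N$. Then all $\tau_k$ are almost surely finite, and the following hold. 1. For every $d\ge 1$, the law of $(\tau_1,\dots,\tau_d)$ is exchangeable and wide-sense geometric, and for all integers $n_1,\dots,n_d\ge0$, with $n_{(1)}\le\dots\le n_{(d)}$ their ordered list and $n_{(0)}=0$, $$\mathbb P(\tau_1>n_1,\dots,\tau_d>n_d)=\prod_{k=1}^d\beta_k^{\,n_{(d-k+1)}-n_{(d-k)}},\qquad \beta_k=\mathbb E\big[e^{-kX_1}\big]$$ (with $e^{-\infty}=0$ and $0^0=1$). 2. The law of $(\tau_1,\dots,\tau_d)$ is narrow-sense geometric for all $d\ge2$ if and only if the law of $X_1$ is infinitely divisible. 3. Every extendible wide-sense geometric law on $\mathbb N^d$, $d\ge1$, is the law of $(\tau_1,\dots,\tau_d)$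 for some such sequences $(X_k)$ and $(E_k)$. Every extendible narrow-sense geometric law on $\mathbb N^d$, $d\ge1$, is the law of $(\tau_1,\dots,\tau_d)$ for some such sequences with $X_1$ infinitely divisible. -/

import Mathlib

open MeasureTheory ProbabilityTheory
open scoped ENNReal

noncomputable section

namespace MultiGeo

/-- The geometric law `Geo(1 - p)` on `{1, 2, …} ∪ {∞}`, `p ∈ [0,1]`: the number of the trial
of the first success, for independent trials with failure probability `p`, that is
`P(τ > n) = p ^ n`. Mathlib's `geometricMeasure` counts the failures before the first success.
For `p = 1` all the mass is at `∞`. -/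
def geoLaw (p : unitInterval) : Measure ℕ∞ :=
  if p = 1 then Measure.dirac ⊤
  else (geometricMeasure (unitInterval.symm p)).map (fun n : ℕ => (n : ℕ∞) + 1)

instance (p : unitInterval) : IsProbabilityMeasure (geoLaw p) := by
  unfold geoLaw
  split_ifs
  · infer_instance
  · exact Measure.isProbabilityMeasure_map (Measurable.of_discrete).aemeasurable

/-- `τ_k = min {E_I : k ∈ I}` for shocks `E_I` indexed by the nonempty subsets of the
components. -/
def shockMin {d : ℕ} (e : {I : Finset (Fin d) // I.Nonempty} → ℕ∞) (k : Fin d) : ℕ∞ :=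
  ⨅ I : {I : Finset (Fin d) // I.Nonempty}, ⨅ _ : k ∈ I.1, e I

/-- `μ` is a `d`-variate narrow-sense geometric law: the law of `τ_k = min {E_I : k ∈ I}`,
`k = 1, …, d`, for independent shocks `E_I ∼ Geo(1 - p_I)`, `∅ ≠ I ⊆ {1, …, d}`, with
parameters `p_I ∈ [0,1]` such that `∏_{I ∋ k} p_I < 1` for every `k`. -/
def IsNarrowGeometric {d : ℕ} (μ : Measure (Fin d → ℕ∞)) : Prop :=
  ∃ p : {I : Finset (Fin d) // I.Nonempty} → unitInterval,
    (∀ k : Fin d,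
      ∏ I : {I : Finset (Fin d) // I.Nonempty} with k ∈ I.1, (p I : ℝ) < 1) ∧
    μ = (Measure.pi fun I => geoLaw (p I)).map shockMin

/-- For a sequence `ω` of outcomes `ω 0, ω 1, …` of the trials number `1, 2, …`, the number of
the first trial whose outcome is `I` (and `∞` if there is none). -/
def firstTrial {d : ℕ} (ω : ℕ → Finset (Fin d)) (I : Finset (Fin d)) : ℕ∞ :=
  ⨅ n : ℕ, ⨅ _ : ω n = I, (n : ℕ∞) + 1

/-- `τ_k = min {Ẽ_I : k ∈ I}`, where `Ẽ_I` is the number of the first trial with outcome `I`. -/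
def trialMin {d : ℕ} (ω : ℕ → Finset (Fin d)) (k : Fin d) : ℕ∞ :=
  ⨅ I : Finset (Fin d), ⨅ _ : k ∈ I, firstTrial ω I

/-- `μ` is a `d`-variate wide-sense geometric law: the law of `τ_k = min {Ẽ_I : k ∈ I}`,
`k = 1, …, d`, where an experiment with outcomes `I ⊆ {1, …, d}` of probabilities `p_I`
(with `∑_{I ∌ k} p_I < 1` for every `k`) is repeated independently, and `Ẽ_I` is the number of
the first trial with outcome `I`. -/
def IsWideGeometric {d : ℕ} (μ : Measure (Fin d → ℕ∞)) : Prop :=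
  ∃ p : PMF (Finset (Fin d)),
    (∀ k : Fin d, ∑ I : Finset (Fin d) with k ∉ I, p I < 1) ∧
    μ = (Measure.infinitePi fun _ : ℕ => p.toMeasure).map trialMin

/-- The law `μ` of a random vector is exchangeable. -/
def IsExchangeable {d : ℕ} (μ : Measure (Fin d → ℕ∞)) : Prop :=
  ∀ σ : Equiv.Perm (Fin d), μ.map (fun x i => x (σ i)) = μ

/-- The law of the first `m` members of a random sequence with law `ν`. -/
def initialBlock (ν : Measure (ℕ → ℕ∞)) (m : ℕ) : Measure (Fin m → ℕ∞) :=
  ν.map (fun x i => x i)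

/-- `μ` is an extendible geometric law, in the sense of the class `C` (narrow-sense or wide-sense
geometric laws): it is the law of the first `d` members of an infinite exchangeable sequence all
of whose finite blocks have laws in `C`. -/
def IsExtendible (C : ∀ m : ℕ, Measure (Fin m → ℕ∞) → Prop) {d : ℕ}
    (μ : Measure (Fin d → ℕ∞)) : Prop :=
  ∃ ν : Measure (ℕ → ℕ∞), IsProbabilityMeasure ν ∧
    (∀ m : ℕ, 1 ≤ m → IsExchangeable (initialBlock ν m) ∧ C m (initialBlock ν m)) ∧
    initialBlock ν d = μ

/-- The order statistic `n_(j)`, `1 ≤ j ≤ d`, of `n_1, …, n_d`, that is the `j`-th smallest of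
them, with the convention `n_(0) = 0`. -/
def orderStat {d : ℕ} (n : Fin d → ℕ) (j : ℕ) : ℕ :=
  if h : 1 ≤ j ∧ j ≤ d then n (Tuple.sort n ⟨j - 1, by omega⟩) else 0

/-- Infinite divisibility of a law on `[0,∞]`: for every `n ≥ 2` it is the law of a sum of `n`
independent and identically distributed `[0,∞]`-valued random variables. -/
def IsInfinitelyDivisible (κ : Measure ℝ≥0∞) : Prop :=
  ∀ n : ℕ, 2 ≤ n → ∃ ρ : Measure ℝ≥0∞, IsProbabilityMeasure ρ ∧
    (Measure.pi fun _ : Fin n => ρ).map (fun x => ∑ i, x i) = κ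

/-- The random walk model: `X 0, X 1, …` are i.i.d. `[0,∞]`-valued and not almost surely zero,
`E 0, E 1, …` are i.i.d. with the exponential law of rate one, and the two sequences are
independent. (`X k` and `E k` are what is usually written `X_{k+1}` and `E_{k+1}`.) -/
structure IsModel {Ω : Type*} [MeasurableSpace Ω] (P : Measure Ω)
    (X : ℕ → Ω → ℝ≥0∞) (E : ℕ → Ω → ℝ) : Prop where
  prob : IsProbabilityMeasure P
  measurable_X : ∀ k, Measurable (X k)
  measurable_E : ∀ k, Measurable (E k)
  indep_X : iIndepFun X P
  ident_X : ∀ k, IdentDistrib (X k) (X 0) P P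
  indep_E : iIndepFun E P
  law_E : ∀ k, P.map (E k) = expMeasure 1
  indep_X_E : IndepFun (fun ω k => X k ω) (fun ω k => E k ω) P
  X_ne_zero : 0 < P {ω | 0 < X 0 ω}

/-- `τ_{k+1} = min {n ∈ {1, 2, …} : X_1 + … + X_n ≥ E_{k+1}}`, which is `∞` if there is no
such `n`. -/
def hit {Ω : Type*} (X : ℕ → Ω → ℝ≥0∞) (E : ℕ → Ω → ℝ) (k : ℕ) (ω : Ω) : ℕ∞ :=
  ⨅ n : ℕ, ⨅ _ : 1 ≤ n ∧ ENNReal.ofReal (E k ω) ≤ ∑ i ∈ Finset.range n, X i ω, (n : ℕ∞)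

/-- The law of `(τ_1, …, τ_d)`. -/
def hitLaw {Ω : Type*} [MeasurableSpace Ω] (P : Measure Ω)
    (X : ℕ → Ω → ℝ≥0∞) (E : ℕ → Ω → ℝ) (d : ℕ) : Measure (Fin d → ℕ∞) :=
  P.map (fun ω i => hit X E i ω)

/-- `E[exp(-k Y)]`, with `exp(-∞) = 0` and `0 · ∞ = 0`. -/
def laplace {Ω : Type*} [MeasurableSpace Ω] (P : Measure Ω) (Y : Ω → ℝ≥0∞) (k : ℕ) : ℝ≥0∞ :=
  ∫⁻ ω, EReal.exp (-(((k : ℝ≥0∞) * Y ω : ℝ≥0∞) : EReal)) ∂P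

end MultiGeo

end

open MultiGeo

namespace MultiGeo

open Filter Topology

/-! Every law in play has a survival function that factorizes over trials: the probability of `τ_i >
n_i` for all `i` is the product over `j` of `g {i | j < n i}`, where `g A` is the probability that
all components in `A` survive one trial. This is `HasSurvival`; it determines the law, and the law
determines `g`. Wide-sense laws have `g A = ∑ p_I` over `I` disjoint from `A`, and conversely a law
of this form with `g {k} < 1` is wide-sense, `p` being the law of the set of components that fail in
the first trial. Narrow-sense laws have `g A = ∏ p_I` over `I` meeting `A`. In the model,
conditioning on the walk gives `g A = β_|A|`, which yields part 1.

For part 3, exchangeability makes `g A = b |A|`, so for every large `m` some random subset of `m`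
points misses `A` with probability `b |A|`. The proportion of points outside the subset is a
`[0,1]`-valued variable whose `k`-th moment tends to `b k`. Weak compactness then solves the
Hausdorff moment problem (`exists_moments_unitInterval`), and `-log` of the limit variable serves as
`X_1`.

For part 2, if all blocks are narrow-sense, replacing `p_I` by `p_I ^ (1/n)` replaces `β` by `β ^
(1/n)`, and the moment argument produces an `n`-th convolution root. Conversely, a root of the law
of `X_1` gives a random subset with probabilities `q_I` that misses `A` with probability `β_|A| ^
(1/n)`. Shocks with `p_I = exp (-n q_I)` then have `g A = exp (-n (1 - β_|A| ^ (1/n)))`, which tends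
to `β_|A|`, and a limit point of these parameters represents the block. -/

/-! ### Survival functions that factorize over trials -/

theorem natCast_lt_iInf {ι : Sort*} {f : ι → ℕ∞} {n : ℕ} :
    (n : ℕ∞) < ⨅ i, f i ↔ ∀ i, (n : ℕ∞) < f i := by
  simp only [← ENat.add_one_le_iff (ENat.natCast_ne_top n), le_iInf_iff]

theorem measurable_of_natCast_lt {α : Type*} [MeasurableSpace α] {f : α → ℕ∞}
    (h : ∀ n : ℕ, MeasurableSet {a | (n : ℕ∞) < f a}) : Measurable f := by
  have hle (n : ℕ) : {a | f a = n} = {a | (n : ℕ∞) < f a}ᶜ \ ⋃ m < n, {a | (m : ℕ∞) < f a}ᶜ := by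
    ext a
    simp only [Set.mem_ofPred_eq, Set.mem_sdiff, Set.mem_compl_iff, Set.mem_iUnion, not_lt,
      exists_prop, not_exists, not_and, not_le]
    exact ⟨fun h => ⟨h.le, fun m hm => by rw [h]; exact_mod_cast hm⟩,
      fun h => h.1.antisymm (not_lt.1 fun hlt => by
        obtain ⟨m, hm⟩ := ENat.ne_top_iff_exists.1 (hlt.trans_le le_top).ne
        rw [← hm] at hlt h
        exact absurd (h.2 m (by exact_mod_cast hlt)) (lt_irrefl _))⟩
  have htop : {a | f a = ⊤} = ⋂ n : ℕ, {a | (n : ℕ∞) < f a} := by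
    ext a
    simp [ENat.eq_top_iff_forall_gt]
  refine measurable_to_countable' fun y => ?_
  induction y using ENat.recTopCoe with
  | top =>
    change MeasurableSet {a | f a = ⊤}
    rw [htop]
    exact .iInter h
  | coe n =>
    change MeasurableSet {a | f a = n}
    rw [hle]
    exact (h n).compl.diff (.iUnion fun m => .iUnion fun _ => (h m).compl)

/-- The joint survival function of `μ` is the one obtained by repeating an experiment
independently, where all components in `A` survive one trial with probability `g A`. -/
def HasSurvival {d : ℕ} (μ : Measure (Fin d → ℕ∞)) (g : Finset (Fin d) → ℝ≥0∞) : Prop :=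
  IsProbabilityMeasure μ ∧ ∀ (n : Fin d → ℕ) (N : ℕ), (∀ i, n i ≤ N) →
    μ {x | ∀ i, (n i : ℕ∞) < x i} = ∏ j ∈ Finset.range N, g {i | j < n i}

namespace HasSurvival

variable {d : ℕ} {μ ν : Measure (Fin d → ℕ∞)} {g g' : Finset (Fin d) → ℝ≥0∞}

theorem ae_pos (h : HasSurvival μ g) : ∀ᵐ x ∂μ, ∀ i, 0 < x i := by
  have := h.1
  rw [ae_iff_prob_eq_one (Measurable.of_discrete)]
  simpa using h.2 (fun _ => 0) 0 (by simp)

theorem measure_forall_mem (h : HasSurvival μ g) (A : Finset (Fin d)) (n : Fin d → ℕ) (N : ℕ)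
    (hN : ∀ i ∈ A, n i ≤ N) :
    μ {x | ∀ i ∈ A, (n i : ℕ∞) < x i} =
      ∏ j ∈ Finset.range N, g {i | j < if i ∈ A then n i else 0} := by
  rw [← h.2 (fun i => if i ∈ A then n i else 0) N fun i => by
    split_ifs with hi; exacts [hN i hi, Nat.zero_le _]]
  refine measure_congr ?_
  filter_upwards [h.ae_pos] with x hx
  refine propext ⟨fun H i => ?_, fun H i hi => ?_⟩
  · by_cases hi : i ∈ A
    · simpa [hi] using H i hi
    · simpa [hi] using hx i
  · simpa [hi] using H i

theorem measure_one_lt (h : HasSurvival μ g) (A : Finset (Fin d)) :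
    μ {x | ∀ i ∈ A, 1 < x i} = g A := by
  have := h.measure_forall_mem A (fun _ => 1) 1 (by simp)
  simp only [Nat.cast_one, Finset.range_one, Finset.prod_singleton] at this
  rw [this]
  congr 1
  ext i
  by_cases hi : i ∈ A <;> simp [hi]

theorem ext (hμ : HasSurvival μ g) (hν : HasSurvival ν g) : μ = ν := by
  have := hμ.1
  have := hν.1
  -- Only coordinates in `a.1` are constrained, so single-coordinate events belong to the π-system.
  -- The survival function still gives their measure, since all coordinates are almost surely
  -- positive.
  let B : Finset (Fin d) × (Fin d → ℕ) → Set (Fin d → ℕ∞) :=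
    fun a => {x | ∀ i ∈ a.1, (a.2 i : ℕ∞) < x i}
  refine ext_of_generate_finite (Set.range B) (le_antisymm ?_ ?_) ?_ ?_ (by simp)
  · refine iSup_le fun i => ?_
    rw [← measurable_iff_comap_le]
    refine @measurable_of_natCast_lt _ (MeasurableSpace.generateFrom _) _ fun n => ?_
    exact MeasurableSpace.measurableSet_generateFrom ⟨({i}, fun _ => n), by simp [B]⟩
  · refine MeasurableSpace.generateFrom_le ?_
    rintro _ ⟨a, rfl⟩
    exact MeasurableSet.of_discrete
  · rintro _ ⟨a, rfl⟩ _ ⟨b, rfl⟩ -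
    refine ⟨(a.1 ∪ b.1, fun i => max (if i ∈ a.1 then a.2 i else 0)
      (if i ∈ b.1 then b.2 i else 0)), ?_⟩
    ext x
    simp only [B, Set.mem_inter_iff, Set.mem_ofPred_eq, Finset.mem_union]
    constructor
    · intro H
      refine ⟨fun i hi => lt_of_le_of_lt ?_ (H i (Or.inl hi)),
        fun i hi => lt_of_le_of_lt ?_ (H i (Or.inr hi))⟩ <;> simp [hi]
    · rintro ⟨ha, hb⟩ i hi
      rcases max_choice (if i ∈ a.1 then a.2 i else 0) (if i ∈ b.1 then b.2 i else 0) with h | h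
      · rw [h]
        split_ifs with h1
        · exact ha i h1
        · exact zero_le.trans_lt (hb i (hi.resolve_left h1))
      · rw [h]
        split_ifs with h1
        · exact hb i h1
        · exact zero_le.trans_lt (ha i (hi.resolve_right h1))
  · rintro _ ⟨a, rfl⟩
    have hN : ∀ i ∈ a.1, a.2 i ≤ ∑ i, a.2 i :=
      fun i _ => Finset.single_le_sum (f := a.2) (fun _ _ => Nat.zero_le _) (Finset.mem_univ i)
    rw [hμ.measure_forall_mem _ _ _ hN, hν.measure_forall_mem _ _ _ hN]

theorem unique (hμ : HasSurvival μ g) (hν : HasSurvival μ g') : g = g' := by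
  ext A; rw [← hμ.measure_one_lt, hν.measure_one_lt]

/-- The set of components with `x i ≤ 1`, those failing in the first trial, is the random subset: it
misses `A` exactly when all components in `A` survive that trial. -/
theorem exists_pmf (h : HasSurvival μ g) :
    ∃ p : PMF (Finset (Fin d)), ∀ A, ∑ I with Disjoint I A, p I = g A := by
  have := h.1
  let F : (Fin d → ℕ∞) → Finset (Fin d) := fun x => {i | x i ≤ 1}
  have hF : Measurable F := Measurable.of_discrete
  have := Measure.isProbabilityMeasure_map (μ := μ) hF.aemeasurable
  refine ⟨(μ.map F).toPMF, fun A => ?_⟩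
  simp only [Measure.toPMF_apply, sum_measure_singleton]
  rw [Measure.map_apply hF MeasurableSet.of_discrete, ← h.measure_one_lt]
  congr 1
  ext x
  simp [F, Finset.disjoint_left]
  exact ⟨fun H i hi => not_le.1 fun h => H h hi, fun H i hi hA => absurd (H i hA) (not_lt.2 hi)⟩

end HasSurvival

/-! ### Wide-sense and narrow-sense laws through their survival functions -/

theorem natCast_lt_trialMin {d : ℕ} {ω : ℕ → Finset (Fin d)} {k : Fin d} {n : ℕ} :
    (n : ℕ∞) < trialMin ω k ↔ ∀ j < n, k ∉ ω j := by
  simp only [trialMin, firstTrial, natCast_lt_iInf]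
  constructor
  · intro h j hj hk
    have := h _ hk j rfl
    norm_cast at this
    omega
  · rintro h I hI j rfl
    by_contra hn
    norm_cast at hn
    exact h j (by omega) hI

theorem measurable_trialMin {d : ℕ} : Measurable (trialMin (d := d)) := by
  refine measurable_pi_iff.2 fun k => measurable_of_natCast_lt fun n => ?_
  simp only [natCast_lt_trialMin]
  measurability

theorem hasSurvival_map_trialMin {d : ℕ} (p : PMF (Finset (Fin d))) :
    HasSurvival ((Measure.infinitePi fun _ : ℕ => p.toMeasure).map trialMin)
      (fun A => ∑ I with Disjoint I A, p I) := by
  refine ⟨Measure.isProbabilityMeasure_map measurable_trialMin.aemeasurable, fun n N hN => ?_⟩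
  rw [Measure.map_apply measurable_trialMin MeasurableSet.of_discrete]
  have : trialMin ⁻¹' {x | ∀ i, (n i : ℕ∞) < x i} =
      Set.pi (Finset.range N)
        fun j => ((({I | Disjoint I ({i | j < n i} : Finset (Fin d))} : Finset _)) :
          Set (Finset (Fin d))) := by
    ext ω
    simp only [Set.mem_preimage, Set.mem_ofPred_eq, natCast_lt_trialMin, Set.mem_pi,
      Finset.coe_range, Set.mem_Iio, Finset.coe_filter, Finset.mem_univ, true_and,
      Finset.disjoint_left, Finset.mem_filter, not_lt]
    constructor
    · intro h j _ i hi
      exact not_lt.1 fun hj => h i j hj hi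
    · intro h i j hj hi
      exact absurd (h j (hj.trans_le (hN i)) hi) (not_le.2 hj)
  rw [this, Measure.infinitePi_pi _ fun _ _ => MeasurableSet.of_discrete]
  refine Finset.prod_congr rfl fun j _ => ?_
  rw [PMF.toMeasure_apply_finset]

theorem isWideGeometric_iff {d : ℕ} {μ : Measure (Fin d → ℕ∞)} :
    IsWideGeometric μ ↔ ∃ g, HasSurvival μ g ∧ ∀ k, g {k} < 1 := by
  constructor
  · rintro ⟨p, hp, rfl⟩
    exact ⟨_, hasSurvival_map_trialMin p, by simpa using hp⟩
  · rintro ⟨g, h, hg⟩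
    obtain ⟨p, hp⟩ := h.exists_pmf
    refine ⟨p, fun k => by simpa [← hp] using hg k, h.ext ?_⟩
    simpa only [hp] using hasSurvival_map_trialMin p

theorem geoLaw_Ioi (p : unitInterval) (n : ℕ) :
    geoLaw p (Set.Ioi (n : ℕ∞)) = ENNReal.ofReal p ^ n := by
  unfold geoLaw
  split_ifs with hp
  · simp [hp]
  · have hp' : unitInterval.symm p ≠ 0 := by simpa [unitInterval.symm_eq_zero] using hp
    have hpre : (fun n : ℕ => (n : ℕ∞) + 1) ⁻¹' Set.Ioi (n : ℕ∞) =
        (Finset.range n : Set ℕ)ᶜ := by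
      ext k
      simp only [Set.mem_preimage, Set.mem_Ioi, Finset.coe_range, Set.mem_compl_iff, Set.mem_Iio]
      norm_cast
      omega
    rw [Measure.map_apply Measurable.of_discrete MeasurableSet.of_discrete, hpre,
      prob_compl_eq_one_sub MeasurableSet.of_discrete, ← sum_measure_singleton]
    simp only [geometricMeasure_singleton hp', unitInterval.coe_symm_eq, sub_sub_cancel]
    have h0 : (0 : ℝ) ≤ p := p.2.1
    have h1 : (p : ℝ) ≤ 1 := p.2.2
    rw [← ENNReal.ofReal_sum_of_nonneg fun k _ => by
        exact mul_nonneg (pow_nonneg h0 _) (sub_nonneg.2 h1),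
      ← Finset.sum_mul, geom_sum_mul_neg, ← ENNReal.ofReal_one,
      ← ENNReal.ofReal_sub _ (sub_nonneg.2 (pow_le_one₀ h0 h1)), sub_sub_cancel,
      ENNReal.ofReal_pow h0]

theorem natCast_lt_shockMin {d : ℕ} {e : {I : Finset (Fin d) // I.Nonempty} → ℕ∞} {k : Fin d}
    {n : ℕ} : (n : ℕ∞) < shockMin e k ↔ ∀ I, k ∈ I.1 → (n : ℕ∞) < e I := by
  simp only [shockMin, natCast_lt_iInf]

theorem hasSurvival_map_shockMin {d : ℕ} (p : {I : Finset (Fin d) // I.Nonempty} → unitInterval) :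
    HasSurvival ((Measure.pi fun I => geoLaw (p I)).map shockMin)
      (fun A => ∏ I with ¬ Disjoint I.1 A, ENNReal.ofReal (p I)) := by
  have hm : Measurable (shockMin (d := d)) := Measurable.of_discrete
  refine ⟨Measure.isProbabilityMeasure_map hm.aemeasurable, fun n N hN => ?_⟩
  rw [Measure.map_apply hm MeasurableSet.of_discrete]
  have : shockMin ⁻¹' {x | ∀ i, (n i : ℕ∞) < x i} =
      Set.pi Set.univ fun I : {I : Finset (Fin d) // I.Nonempty} =>
        Set.Ioi ((I.1.sup n : ℕ) : ℕ∞) := by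
    ext e
    simp only [Set.mem_preimage, Set.mem_ofPred_eq, natCast_lt_shockMin, Set.mem_pi, Set.mem_univ,
      true_imp_iff, Set.mem_Ioi]
    constructor
    · intro h I
      obtain ⟨i, hi, hs⟩ := Finset.exists_mem_eq_sup I.1 I.2 n
      rw [hs]
      exact h i I hi
    · intro h i I hi
      exact lt_of_le_of_lt (by exact_mod_cast Finset.le_sup hi) (h I)
  rw [this, Measure.pi_pi]
  simp only [geoLaw_Ioi, Finset.prod_filter]
  rw [Finset.prod_comm]
  refine Finset.prod_congr rfl fun I _ => ?_
  rw [← Finset.prod_filter, Finset.prod_const]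
  congr 1
  -- The shock `I` must outlast the largest `n i` with `i ∈ I`; this exponent counts the trials `j`
  -- in which `I` meets the set of components still required to survive.
  have : ({j ∈ Finset.range N | ¬ Disjoint I.1 ({i | j < n i} : Finset (Fin d))} : Finset ℕ) =
      Finset.range (I.1.sup n) := by
    ext j
    simp only [Finset.mem_filter, Finset.mem_range, Finset.not_disjoint_iff, Finset.mem_univ,
      true_and, Finset.lt_sup_iff]
    exact ⟨fun h => h.2, fun ⟨i, hi, hj⟩ => ⟨hj.trans_le (hN i), i, hi, hj⟩⟩
  rw [this, Finset.card_range]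

theorem isNarrowGeometric_iff {d : ℕ} {μ : Measure (Fin d → ℕ∞)} :
    IsNarrowGeometric μ ↔ ∃ p : {I : Finset (Fin d) // I.Nonempty} → unitInterval,
      HasSurvival μ (fun A => ∏ I with ¬ Disjoint I.1 A, ENNReal.ofReal (p I)) ∧
      ∀ k, ∏ I with ¬ Disjoint I.1 {k}, ENNReal.ofReal (p I) < 1 := by
  have key (p : {I : Finset (Fin d) // I.Nonempty} → unitInterval) (k : Fin d) :
      ∏ I with ¬ Disjoint I.1 {k}, ENNReal.ofReal (p I) < 1 ↔
        ∏ I : {I : Finset (Fin d) // I.Nonempty} with k ∈ I.1, (p I : ℝ) < 1 := by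
    rw [← ENNReal.ofReal_prod_of_nonneg fun I _ => (p I).2.1, ENNReal.ofReal_lt_one]
    simp
  refine exists_congr fun p => ?_
  simp only [key]
  constructor
  · rintro ⟨hp, rfl⟩
    exact ⟨hasSurvival_map_shockMin p, hp⟩
  · rintro ⟨h, hp⟩
    exact ⟨hp, h.ext (hasSurvival_map_shockMin p)⟩

theorem IsNarrowGeometric.isWideGeometric {d : ℕ} {μ : Measure (Fin d → ℕ∞)}
    (h : IsNarrowGeometric μ) : IsWideGeometric μ := by
  obtain ⟨p, hp, hk⟩ := isNarrowGeometric_iff.1 h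
  exact isWideGeometric_iff.2 ⟨_, hp, hk⟩

/-! ### The exponential `e^{-x}` on `[0,∞]` -/

/-- `exp (-x)` for `x ∈ [0,∞]`, with `exp (-∞) = 0`. -/
noncomputable def expNeg (x : ℝ≥0∞) : ℝ≥0∞ := EReal.exp (-(x : EReal))

theorem measurable_expNeg : Measurable expNeg := by
  unfold expNeg
  fun_prop

@[simp] theorem expNeg_zero : expNeg 0 = 1 := by simp [expNeg]

theorem expNeg_le_one (x : ℝ≥0∞) : expNeg x ≤ 1 := by
  simp [expNeg, EReal.coe_ennreal_nonneg]

theorem expNeg_lt_one_iff {x : ℝ≥0∞} : expNeg x < 1 ↔ 0 < x := by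
  rw [expNeg, EReal.exp_lt_one_iff, EReal.neg_lt_comm, neg_zero, EReal.coe_ennreal_pos]

theorem expNeg_add (x y : ℝ≥0∞) : expNeg (x + y) = expNeg x * expNeg y := by
  rw [expNeg, EReal.coe_ennreal_add, EReal.neg_add, sub_eq_add_neg, EReal.exp_add]
  · rfl
  · left; simp
  · right; simp

theorem expNeg_sum {ι : Type*} (s : Finset ι) (f : ι → ℝ≥0∞) :
    expNeg (∑ i ∈ s, f i) = ∏ i ∈ s, expNeg (f i) := by
  classical
  induction s using Finset.induction_on with
  | empty => simp
  | insert i s hi ih => rw [Finset.sum_insert hi, Finset.prod_insert hi, expNeg_add, ih]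

theorem expNeg_natCast_mul (k : ℕ) (x : ℝ≥0∞) : expNeg (k * x) = expNeg x ^ k := by
  simpa using expNeg_sum (Finset.range k) fun _ => x

theorem laplace_eq {Ω : Type*} [MeasurableSpace Ω] (P : Measure Ω) (Y : Ω → ℝ≥0∞) (k : ℕ) :
    laplace P Y k = ∫⁻ ω, expNeg (Y ω) ^ k ∂P := by
  simp only [laplace, ← expNeg_natCast_mul]
  rfl

theorem laplace_eq_map {Ω : Type*} [MeasurableSpace Ω] (P : Measure Ω) {Y : Ω → ℝ≥0∞}
    (hY : Measurable Y) (k : ℕ) : laplace P Y k = ∫⁻ x, expNeg x ^ k ∂(P.map Y) := by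
  rw [laplace_eq, lintegral_map (measurable_expNeg.pow_const k) hY]

theorem lintegral_expNeg_lt_one {ρ : Measure ℝ≥0∞} [IsProbabilityMeasure ρ] :
    ∫⁻ x, expNeg x ∂ρ < 1 ↔ 0 < ρ {x | 0 < x} := by
  constructor
  · intro h
    rw [pos_iff_ne_zero]
    intro h0
    have : ∀ᵐ x ∂ρ, expNeg x = 1 := by
      filter_upwards [measure_eq_zero_iff_ae_notMem.1 h0] with x hx
      have : x = 0 := by simpa using hx
      simp [this]
    rw [lintegral_congr_ae this] at h
    simp at h
  · intro h
    have hle : ∫⁻ x, expNeg x ∂ρ ≤ ∫⁻ _, 1 ∂ρ := lintegral_mono fun x => expNeg_le_one x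
    rw [lintegral_const, measure_univ, one_mul] at hle
    refine hle.lt_of_ne fun heq => h.ne' ?_
    have hae := ae_eq_of_ae_le_of_lintegral_le (μ := ρ) (f := expNeg) (g := fun _ => 1)
      (ae_of_all _ expNeg_le_one) (by simp [heq]) aemeasurable_const (by simp [heq])
    refine measure_mono_null ?_ hae
    intro x hx
    exact (expNeg_lt_one_iff.2 hx).ne

theorem expMeasure_one_setOf_lt (s : ℝ≥0∞) :
    expMeasure 1 {e | s < ENNReal.ofReal e} = expNeg s := by
  have := isProbabilityMeasure_expMeasure (r := 1) one_pos
  induction s using ENNReal.recTopCoe with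
  | top => simp [expNeg]
  | coe r =>
    have h : {e : ℝ | (r : ℝ≥0∞) < ENNReal.ofReal e} = (Set.Iic (r : ℝ))ᶜ := by
      ext e
      simp [ENNReal.lt_ofReal_iff_toReal_lt]
    rw [h, prob_compl_eq_one_sub measurableSet_Iic, ← ofReal_cdf, cdf_expMeasure_eq one_pos,
      if_pos r.coe_nonneg, ← ENNReal.ofReal_one, ← ENNReal.ofReal_sub _
        (sub_nonneg.2 (Real.exp_le_one_iff.2 (by simp)))]
    simp [expNeg, EReal.coe_nnreal_eq_coe_real, ← EReal.coe_neg]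

/-! ### First passage times of the random walk -/

theorem natCast_lt_hit {Ω : Type*} {X : ℕ → Ω → ℝ≥0∞} {E : ℕ → Ω → ℝ} {k n : ℕ} {ω : Ω}
    (hE : 0 < E k ω) :
    (n : ℕ∞) < hit X E k ω ↔ ∑ i ∈ Finset.range n, X i ω < ENNReal.ofReal (E k ω) := by
  simp only [hit, natCast_lt_iInf]
  constructor
  · intro h
    by_contra! hle
    refine absurd (h n ⟨?_, hle⟩) (lt_irrefl _)
    -- The minimum runs over `n ≥ 1`; the case `n = 0` is excluded because the empty sum does not
    -- reach `E k ω > 0`.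
    rw [Nat.one_le_iff_ne_zero]
    rintro rfl
    simp [hE.not_ge] at hle
  · rintro h m ⟨-, hm⟩
    by_contra! hmn
    have hmn : m ≤ n := by exact_mod_cast hmn
    exact absurd (hm.trans (Finset.sum_le_sum_of_subset (Finset.range_mono hmn))) (not_le.2 h)

section Model

variable {Ω : Type*} [MeasurableSpace Ω] {P : Measure Ω} {X : ℕ → Ω → ℝ≥0∞} {E : ℕ → Ω → ℝ}

theorem measurable_hit (hX : ∀ k, Measurable (X k)) (hE : ∀ k, Measurable (E k)) (k : ℕ) :
    Measurable (hit X E k) := by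
  refine measurable_of_natCast_lt fun n => ?_
  simp only [hit, natCast_lt_iInf]
  have hS (m : ℕ) : Measurable fun ω => ∑ i ∈ Finset.range m, X i ω := by fun_prop
  have hm (m : ℕ) : MeasurableSet
      {ω | ENNReal.ofReal (E k ω) ≤ ∑ i ∈ Finset.range m, X i ω} :=
    measurableSet_le (hE k).ennreal_ofReal (hS m)
  refine MeasurableSet.congr (s := ⋂ m : ℕ, ⋂ _ : 1 ≤ m ∧ m ≤ n,
    {ω | ENNReal.ofReal (E k ω) ≤ ∑ i ∈ Finset.range m, X i ω}ᶜ)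
    (.iInter fun m => .iInter fun _ => (hm m).compl) ?_
  ext ω
  simp only [Set.mem_iInter, Set.mem_compl_iff, Set.mem_ofPred_eq, and_imp, Nat.cast_lt]
  exact ⟨fun h m h1 h2 => not_le.1 fun h3 => h m h1 h3 h2,
    fun h m h1 h2 h3 => absurd (h m h1 h3) (not_lt.2 h2)⟩

namespace IsModel

theorem measure_forall_lt (h : IsModel P X E) {d : ℕ} (s : Fin d → ℝ≥0∞) :
    P {ω | ∀ i, s i < ENNReal.ofReal (E i ω)} = ∏ i, expNeg (s i) := by
  have := (h.indep_E.precomp (g := ((↑) : Fin d → ℕ)) Fin.val_injective)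
    |>.measure_inter_preimage_eq_mul Finset.univ
    (sets := fun i => {e : ℝ | s i < ENNReal.ofReal e})
    fun i _ => measurableSet_lt measurable_const ENNReal.measurable_ofReal
  convert this using 1
  · congr 1
    ext ω
    simp
  · refine Finset.prod_congr rfl fun i _ => ?_
    rw [← expMeasure_one_setOf_lt, ← h.law_E i, Measure.map_apply (h.measurable_E i)
      (measurableSet_lt measurable_const ENNReal.measurable_ofReal)]

theorem ae_pos (h : IsModel P X E) : ∀ᵐ ω ∂P, ∀ k, 0 < E k ω := by
  have := h.prob
  refine ae_all_iff.2 fun k => ?_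
  have hm : MeasurableSet {e : ℝ | 0 < ENNReal.ofReal e} :=
    measurableSet_lt measurable_const ENNReal.measurable_ofReal
  have h1 := expMeasure_one_setOf_lt 0
  rw [← h.law_E k, Measure.map_apply (h.measurable_E k) hm, expNeg_zero] at h1
  filter_upwards [(mem_ae_iff_prob_eq_one (h.measurable_E k hm)).2 h1] with ω hω
  simpa using hω

/-- Fubini: by independence the walk may be frozen, and then the `E i` exceed their thresholds
independently, each with probability `exp` of minus the threshold. -/
theorem measure_forall_sum_lt (h : IsModel P X E) {d : ℕ} (n : Fin d → ℕ) :
    P {ω | ∀ i, ∑ j ∈ Finset.range (n i), X j ω < ENNReal.ofReal (E i ω)} =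
      ∫⁻ ω, ∏ i, expNeg (∑ j ∈ Finset.range (n i), X j ω) ∂P := by
  have := h.prob
  have hX : Measurable fun ω k => X k ω := measurable_pi_lambda _ h.measurable_X
  have hE : Measurable fun ω k => E k ω := measurable_pi_lambda _ h.measurable_E
  have := Measure.isProbabilityMeasure_map (μ := P) hE.aemeasurable
  have hS (i : Fin d) : Measurable fun x : ℕ → ℝ≥0∞ => ∑ j ∈ Finset.range (n i), x j := by fun_prop
  let B : Set ((ℕ → ℝ≥0∞) × (ℕ → ℝ)) :=
    {z | ∀ i : Fin d, ∑ j ∈ Finset.range (n i), z.1 j < ENNReal.ofReal (z.2 i)}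
  have hB : MeasurableSet B := by
    have : B = ⋂ i : Fin d,
        {z | ∑ j ∈ Finset.range (n i), z.1 j < ENNReal.ofReal (z.2 i)} := by
      ext; simp [B]
    rw [this]
    exact .iInter fun i => measurableSet_lt (by fun_prop) (by fun_prop)
  calc _ = P.map (fun ω => ((fun k => X k ω), (fun k => E k ω))) B := by
        rw [Measure.map_apply (hX.prodMk hE) hB]
        rfl
    _ = ∫⁻ x, ∏ i, expNeg (∑ j ∈ Finset.range (n i), x j) ∂(P.map fun ω k => X k ω) := by
        rw [(indepFun_iff_map_prod_eq_prod_map_map hX.aemeasurable hE.aemeasurable).1 h.indep_X_E,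
          Measure.prod_apply hB]
        refine lintegral_congr fun x => ?_
        rw [Measure.map_apply hE (measurable_prodMk_left hB), ← h.measure_forall_lt]
        rfl
    _ = _ := by
        rw [lintegral_map _ hX]
        exact Finset.measurable_fun_prod _ fun i _ => measurable_expNeg.comp (hS i)

theorem measurable_hit_fin (h : IsModel P X E) (d : ℕ) :
    Measurable fun ω (i : Fin d) => hit X E i ω :=
  measurable_pi_lambda _ fun i => measurable_hit h.measurable_X h.measurable_E i

/-- The increment `X j` enters the partial sum of length `n i` exactly for those `i` with `j < n i`.
Regrouping the exponentials by increments, independence splits the expectation. -/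
theorem measure_forall_lt_hit (h : IsModel P X E) {d : ℕ} (n : Fin d → ℕ) (N : ℕ)
    (hN : ∀ i, n i ≤ N) :
    P {ω | ∀ i, (n i : ℕ∞) < hit X E i ω} =
      ∏ j ∈ Finset.range N, laplace P (X 0) (Finset.card {i | j < n i}) := by
  have hswap (ω : Ω) : ∏ i, expNeg (∑ j ∈ Finset.range (n i), X j ω) =
      ∏ j ∈ Finset.range N, expNeg (X j ω) ^ (Finset.card {i | j < n i}) := by
    simp only [expNeg_sum]
    calc _ = ∏ i, ∏ j ∈ Finset.range N, if j < n i then expNeg (X j ω) else 1 := by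
          refine Finset.prod_congr rfl fun i _ => ?_
          rw [← Finset.prod_filter]
          refine Finset.prod_congr ?_ fun _ _ => rfl
          ext j
          simp only [Finset.mem_range, Finset.mem_filter]
          exact ⟨fun hj => ⟨hj.trans_le (hN i), hj⟩, fun hj => hj.2⟩
      _ = _ := by
          rw [Finset.prod_comm]
          refine Finset.prod_congr rfl fun j _ => ?_
          rw [← Finset.prod_filter, Finset.prod_const]
  calc _ = P {ω | ∀ i, ∑ j ∈ Finset.range (n i), X j ω < ENNReal.ofReal (E i ω)} := by
        refine measure_congr ?_
        filter_upwards [h.ae_pos] with ω hω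
        exact propext (forall_congr' fun i => natCast_lt_hit (hω i))
    _ = ∫⁻ ω, ∏ j ∈ Finset.range N, expNeg (X j ω) ^ (Finset.card {i | j < n i}) ∂P := by
        simp only [h.measure_forall_sum_lt, hswap]
    _ = ∏ j ∈ Finset.range N, ∫⁻ ω, expNeg (X j ω) ^ (Finset.card {i | j < n i}) ∂P :=
        lintegral_prod_eq_prod_lintegral_of_indepFun _ _
          (h.indep_X.comp (fun j x => expNeg x ^ (Finset.card {i | j < n i}))
            fun j => measurable_expNeg.pow_const _)
          fun j => (measurable_expNeg.comp (h.measurable_X j)).pow_const _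
    _ = _ := by
        refine Finset.prod_congr rfl fun j _ => ?_
        rw [laplace_eq]
        exact ((h.ident_X j).comp (measurable_expNeg.pow_const _)).lintegral_eq

theorem hasSurvival_hitLaw (h : IsModel P X E) (d : ℕ) :
    HasSurvival (hitLaw P X E d) fun A => laplace P (X 0) A.card := by
  have := h.prob
  have hm := h.measurable_hit_fin d
  refine ⟨Measure.isProbabilityMeasure_map hm.aemeasurable, fun n N hN => ?_⟩
  rw [hitLaw, Measure.map_apply hm MeasurableSet.of_discrete]
  exact h.measure_forall_lt_hit n N hN

theorem laplace_one_lt_one (h : IsModel P X E) : laplace P (X 0) 1 < 1 := by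
  have := h.prob
  have hX := h.measurable_X 0
  have := Measure.isProbabilityMeasure_map (μ := P) hX.aemeasurable
  rw [laplace_eq_map P hX]
  simp only [pow_one]
  rw [lintegral_expNeg_lt_one,
    Measure.map_apply hX (measurableSet_lt measurable_const measurable_id')]
  exact h.X_ne_zero

/-- Passing beyond every `n` has probability at most `β_1 ^ n`, which tends to `0` as `β_1 < 1`. -/
theorem ae_hit_ne_top (h : IsModel P X E) : ∀ᵐ ω ∂P, ∀ k, hit X E k ω ≠ ⊤ := by
  refine ae_all_iff.2 fun k => ?_
  have hle (n : ℕ) : P {ω | hit X E k ω = ⊤} ≤ laplace P (X 0) 1 ^ n := by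
    -- The other components get threshold `0`, which almost surely is no constraint.
    have h1 := h.measure_forall_lt_hit (d := k + 1) (fun i => if i = Fin.last k then n else 0) n
      (fun i => by split_ifs <;> omega)
    refine (measure_mono_ae ?_).trans (h1.trans_le ?_)
    · have h0 := (h.hasSurvival_hitLaw (k + 1)).ae_pos
      rw [hitLaw, ae_map_iff (h.measurable_hit_fin _).aemeasurable MeasurableSet.of_discrete] at h0
      filter_upwards [h0] with ω hω
      intro htop i
      change hit X E k ω = ⊤ at htop
      split_ifs with hi
      · subst hi
        simp [htop]
      · simpa using hω i
    · refine (Finset.prod_congr rfl fun j hj => ?_).trans_le (by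
        rw [Finset.prod_const, Finset.card_range])
      congr 1
      rw [Finset.card_eq_one]
      refine ⟨Fin.last k, ?_⟩
      ext i
      have := Finset.mem_range.1 hj
      by_cases hi : i = Fin.last k <;> simp [hi, this]
  rw [ae_iff]
  refine le_antisymm (ge_of_tendsto'
    (ENNReal.tendsto_pow_atTop_nhds_zero_of_lt_one h.laplace_one_lt_one) fun n => ?_) zero_le
  simpa only [not_not] using hle n

end IsModel

end Model

theorem exists_isModel (ρ : Measure ℝ≥0∞) [IsProbabilityMeasure ρ] (hρ : 0 < ρ {x | 0 < x}) :
    ∃ (Ω : Type) (_ : MeasurableSpace Ω) (P : Measure Ω) (X : ℕ → Ω → ℝ≥0∞) (E : ℕ → Ω → ℝ),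
      IsModel P X E ∧ P.map (X 0) = ρ := by
  have := isProbabilityMeasure_expMeasure (r := 1) one_pos
  let P₁ := Measure.infinitePi fun _ : ℕ => ρ
  let P₂ := Measure.infinitePi fun _ : ℕ => expMeasure 1
  have h1 : (P₁.prod P₂).map Prod.fst = P₁ := by simp
  have h2 : (P₁.prod P₂).map Prod.snd = P₂ := by simp
  have hX (k : ℕ) : (P₁.prod P₂).map (fun ω => ω.1 k) = ρ := by
    rw [← Function.comp_def (fun x : ℕ → ℝ≥0∞ => x k) Prod.fst,
      ← Measure.map_map (by fun_prop) (by fun_prop), h1]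
    exact Measure.infinitePi_map_eval _ k
  have hE (k : ℕ) : (P₁.prod P₂).map (fun ω => ω.2 k) = expMeasure 1 := by
    rw [← Function.comp_def (fun x : ℕ → ℝ => x k) Prod.snd,
      ← Measure.map_map (by fun_prop) (by fun_prop), h2]
    exact Measure.infinitePi_map_eval _ k
  refine ⟨_, _, P₁.prod P₂, fun k ω => ω.1 k, fun k ω => ω.2 k, ?_, hX 0⟩
  refine ⟨inferInstance, by fun_prop, by fun_prop, ?_, fun k => ⟨by fun_prop, by fun_prop, ?_⟩, ?_,
    hE, ?_, ?_⟩
  · rw [iIndepFun_iff_map_fun_eq_infinitePi_map (by fun_prop)]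
    simp only [hX]
    exact h1
  · rw [hX, hX]
  · rw [iIndepFun_iff_map_fun_eq_infinitePi_map (by fun_prop)]
    simp only [hE]
    exact h2
  · exact indepFun_prod (X := id) (Y := id) measurable_id measurable_id
  · rwa [← hX 0, Measure.map_apply (by fun_prop)
      (measurableSet_lt measurable_const measurable_id')] at hρ

/-! ### Order statistics -/

theorem lt_orderStat_iff {d : ℕ} (n : Fin d → ℕ) {m : ℕ} (hm : m ≤ d) (j : ℕ) :
    j < orderStat n m ↔ d - m < Finset.card {i | j < n i} := by
  unfold orderStat
  split_ifs with h
  · have hcard : Finset.card {i | j < n i} = Finset.card {i | j < n (Tuple.sort n i)} :=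
      (Finset.card_equiv (Tuple.sort n) (by simp)).symm
    have hmono : Monotone (n ∘ Tuple.sort n) := Tuple.monotone_sort n
    rw [hcard]
    set a : Fin d := ⟨m - 1, by omega⟩ with ha
    constructor
    · intro hj
      have : Finset.Ici a ⊆ ({i | j < n (Tuple.sort n i)} : Finset (Fin d)) := fun i hi => by
        simpa using hj.trans_le (hmono (Finset.mem_Ici.1 hi))
      have := Finset.card_le_card this
      rw [Fin.card_Ici] at this
      simp only [ha] at this
      omega
    · intro hj
      by_contra hle
      have : ({i | j < n (Tuple.sort n i)} : Finset (Fin d)) ⊆ Finset.Ioi a := fun i hi => by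
        rw [Finset.mem_Ioi]
        by_contra! hia
        have hi : j < n (Tuple.sort n i) := by simpa using hi
        exact hle (hi.trans_le (hmono hia))
      have := Finset.card_le_card this
      rw [Fin.card_Ioi] at this
      simp only [ha] at this
      omega
  · have : m = 0 := by omega
    subst this
    simpa using Finset.card_le_univ (α := Fin d) _

/-- Trials are grouped by the number `k` of components required to survive them; those with exactly
`k ≥ 1` form the interval from `n_(d-k)` to `n_(d-k+1)`, right end excluded. The group `k = 0`
contributes `β 0 = 1`. -/
theorem prod_card_eq_prod_orderStat {d : ℕ} (β : ℕ → ℝ≥0∞) (h0 : β 0 = 1) (n : Fin d → ℕ) (N : ℕ)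
    (hN : ∀ i, n i ≤ N) :
    ∏ j ∈ Finset.range N, β (Finset.card {i | j < n i}) =
      ∏ k ∈ Finset.Icc 1 d, β k ^ (orderStat n (d - k + 1) - orderStat n (d - k)) := by
  have hmaps : ∀ j ∈ Finset.range N, Finset.card {i | j < n i} ∈ Finset.Icc 0 d := fun j _ => by
    simpa using Finset.card_le_univ (α := Fin d) {i | j < n i}
  rw [← Finset.prod_fiberwise_of_maps_to' hmaps]
  simp only [Finset.prod_const]
  have hsub : Finset.Icc 1 d ⊆ Finset.Icc 0 d := Finset.Icc_subset_Icc_left zero_le_one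
  rw [← Finset.prod_subset hsub fun k hk hk' => by
    have : k = 0 := by simp at hk hk'; omega
    simp [this, h0]]
  refine Finset.prod_congr rfl fun k hk => ?_
  congr 1
  rw [Finset.mem_Icc] at hk
  have : ({j ∈ Finset.range N | Finset.card {i | j < n i} = k} : Finset ℕ) =
      Finset.Ico (orderStat n (d - k)) (orderStat n (d - k + 1)) := by
    ext j
    have h1 := lt_orderStat_iff n (m := d - k) (by omega) j
    have h2 := lt_orderStat_iff n (m := d - k + 1) (by omega) j
    rw [Finset.mem_filter, Finset.mem_range, Finset.mem_Ico, ← not_lt, h1, h2]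
    constructor
    · omega
    · rintro ⟨h3, h4⟩
      refine ⟨?_, by omega⟩
      have : 0 < Finset.card {i | j < n i} := by omega
      obtain ⟨i, hi⟩ := Finset.card_pos.1 this
      exact (show j < n i by simpa using hi).trans_le (hN i)
  rw [this, Nat.card_Ico]

/-! ### The Hausdorff moment problem -/

/-- The power `|Iᶜ| ^ k` counts the maps `Fin k → Fin m` whose image misses `I`; summing over `I`
first leaves the probability of missing each image. -/
theorem sum_toReal_mul_card_compl_pow {m : ℕ} {b : ℕ → ℝ≥0∞} {p : PMF (Finset (Fin m))}
    (hp : ∀ A, ∑ I with Disjoint I A, p I = b A.card) (k : ℕ) :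
    ∑ I, (p I).toReal * (Iᶜ.card : ℝ) ^ k =
      ∑ f : Fin k → Fin m, (b (Finset.univ.image f).card).toReal := by
  have hcard (I : Finset (Fin m)) : (Iᶜ.card : ℝ) ^ k =
      ∑ f : Fin k → Fin m, if Disjoint I (Finset.univ.image f) then (1 : ℝ) else 0 := by
    rw [Finset.sum_boole]
    have : ({f | Disjoint I (Finset.univ.image f)} : Finset (Fin k → Fin m)) =
        Fintype.piFinset fun _ => Iᶜ := by
      ext f
      simp only [Finset.mem_filter, Finset.mem_univ, true_and, Fintype.mem_piFinset,
        Finset.mem_compl, Finset.disjoint_right, Finset.mem_image]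
      exact ⟨fun h a => h ⟨a, rfl⟩, fun h _ ⟨a, ha⟩ => ha ▸ h a⟩
    rw [this, Fintype.card_piFinset_const, Nat.cast_pow]
  simp only [hcard, Finset.mul_sum]
  rw [Finset.sum_comm]
  refine Finset.sum_congr rfl fun f _ => ?_
  rw [← hp, ENNReal.toReal_sum fun I _ => p.apply_ne_top I, Finset.sum_filter]
  simp

/-- Injective maps have images of size `k` and cause no error; each of the others costs at most `1`.
-/
theorem abs_sum_image_card_sub_le {m k : ℕ} {B : ℕ → ℝ} (h0 : ∀ j, 0 ≤ B j) (h1 : ∀ j, B j ≤ 1) :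
    |∑ f : Fin k → Fin m, B (Finset.univ.image f).card - m ^ k * B k| ≤
      m ^ k - m.descFactorial k := by
  classical
  have hinj : (Finset.card {f : Fin k → Fin m | f.Injective} : ℝ) = m.descFactorial k := by
    rw [← Fintype.card_subtype,
      Fintype.card_congr (Equiv.subtypeInjectiveEquivEmbedding (Fin k) (Fin m)),
      Fintype.card_embedding_eq, Fintype.card_fin, Fintype.card_fin]
  have hall : (Finset.card (Finset.univ : Finset (Fin k → Fin m)) : ℝ) = m ^ k := by simp
  have hsplit := Finset.card_filter_add_card_filter_not
    (s := (Finset.univ : Finset (Fin k → Fin m)))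
    (fun f => f.Injective)
  have hnot : (Finset.card {f : Fin k → Fin m | ¬ f.Injective} : ℝ) =
      m ^ k - m.descFactorial k := by
    rw [← hinj, ← hall, ← hsplit]
    push_cast
    ring
  rw [← hnot, ← hall, ← nsmul_eq_mul, ← Finset.sum_const, ← Finset.sum_sub_distrib,
    Finset.card_eq_sum_ones, Finset.sum_filter]
  push_cast
  refine (Finset.abs_sum_le_sum_abs _ _).trans (Finset.sum_le_sum fun f _ => ?_)
  split_ifs with hf
  · simp [Finset.card_image_of_injective _ hf]
  · exact abs_sub_le_of_nonneg_of_le (h0 _) (h1 _) (h0 _) (h1 _)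

/-- A solution of the Hausdorff moment problem: if for all large `m` there is a random subset of
`{1, …, m}` which misses `A` with probability `b |A|`, then `b` is the sequence of moments of a
law on the unit interval. -/
theorem exists_moments_unitInterval {b : ℕ → ℝ≥0∞}
    (h : ∀ᶠ m : ℕ in atTop, ∃ p : PMF (Finset (Fin m)),
      ∀ A, ∑ I with Disjoint I A, p I = b A.card) :
    ∃ μ : ProbabilityMeasure unitInterval, ∀ k, ∫ x, (x : ℝ) ^ k ∂(μ : Measure unitInterval) =
      (b k).toReal := by
  obtain ⟨m₀, h⟩ := eventually_atTop.1 h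
  -- The shift by `m₀ + 1` keeps the ground set beyond the threshold and nonempty, so its size may
  -- be divided by.
  choose p hp using fun m : ℕ => h (m + (m₀ + 1)) (by omega)
  have hb (k : ℕ) : b k ≤ 1 := by
    have hk : k ≤ Fintype.card (Fin (k + (m₀ + 1))) := by simp
    obtain ⟨A, -, hA⟩ := Finset.exists_subset_card_eq hk
    rw [← hA, ← hp k A, ← (p k).tsum_coe, tsum_fintype]
    exact Finset.sum_le_sum_of_subset (Finset.filter_subset _ _)
  let D (m : ℕ) (I : Finset (Fin (m + (m₀ + 1)))) : unitInterval :=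
    ⟨(Iᶜ.card : ℝ) / (m + (m₀ + 1) : ℕ), by positivity, by
      refine div_le_one_of_le₀ ?_ (by positivity)
      exact_mod_cast (Finset.card_le_univ _).trans_eq (Fintype.card_fin _)⟩
  let μ (m : ℕ) : ProbabilityMeasure unitInterval :=
    ⟨(p m).toMeasure.map (D m),
      Measure.isProbabilityMeasure_map (Measurable.of_discrete).aemeasurable⟩
  have hint (m k : ℕ) : ∫ x, (x : ℝ) ^ k ∂(μ m : Measure unitInterval) =
      (∑ f : Fin k → Fin (m + (m₀ + 1)), (b (Finset.univ.image f).card).toReal) /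
        ((m + (m₀ + 1) : ℕ) : ℝ) ^ k := by
    have hc : Continuous fun x : unitInterval => (x : ℝ) ^ k := by fun_prop
    change ∫ x, (x : ℝ) ^ k ∂((p m).toMeasure.map (D m)) = _
    rw [integral_map (Measurable.of_discrete).aemeasurable hc.aestronglyMeasurable,
      PMF.integral_eq_sum, ← sum_toReal_mul_card_compl_pow (hp m), Finset.sum_div]
    refine Finset.sum_congr rfl fun I _ => ?_
    simp only [D, smul_eq_mul, div_pow, mul_div_assoc]
  have hlim (k : ℕ) : Tendsto (fun m => ∫ x, (x : ℝ) ^ k ∂(μ m : Measure unitInterval)) atTop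
      (𝓝 (b k).toReal) := by
    -- The proportion of non-injective maps, which bounds the error in the `k`-th moment, vanishes
    -- in the limit.
    have hd : Tendsto (fun m : ℕ => 1 - (m.descFactorial k : ℝ) / (m : ℝ) ^ k) atTop (𝓝 0) := by
      have := (Asymptotics.isEquivalent_iff_tendsto_one (by
        filter_upwards [eventually_ge_atTop 1] with m hm
        positivity)).1 (isEquivalent_descFactorial k)
      simpa using this.const_sub 1
    rw [tendsto_iff_dist_tendsto_zero]
    refine squeeze_zero (fun _ => dist_nonneg) (fun m => ?_)
      (hd.comp (tendsto_add_atTop_nat (m₀ + 1)))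
    have hpos : (0 : ℝ) < ((m + (m₀ + 1) : ℕ) : ℝ) ^ k := by positivity
    rw [hint, Real.dist_eq, div_sub' hpos.ne', abs_div, abs_of_pos hpos, div_le_iff₀ hpos]
    refine (abs_sum_image_card_sub_le (fun j => ENNReal.toReal_nonneg)
      fun j => ENNReal.toReal_le_of_le_ofReal zero_le_one (by simpa using hb j)).trans_eq ?_
    simp only [Function.comp_apply]
    field_simp
  -- Probability measures on the compact interval form a compact space, so a nonprincipal
  -- ultrafilter has a limit there; no subsequence is needed.
  obtain ⟨ν, -, hν⟩ := isCompact_univ.ultrafilter_le_nhds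
    (Ultrafilter.map μ (hyperfilter ℕ)) (by simp)
  refine ⟨ν, fun k => ?_⟩
  have hν : Tendsto μ (hyperfilter ℕ) (𝓝 ν) := hν
  rw [ProbabilityMeasure.tendsto_iff_forall_integral_tendsto] at hν
  have h1 := hν (BoundedContinuousFunction.mkOfCompact
    ⟨fun x : unitInterval => (x : ℝ) ^ k, by fun_prop⟩)
  exact tendsto_nhds_unique h1 ((hlim k).mono_left Nat.hyperfilter_le_atTop)

theorem expNeg_toENNReal_neg_log {y : ℝ≥0∞} (hy : y ≤ 1) :
    expNeg (-ENNReal.log y).toENNReal = y := by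
  rw [expNeg, EReal.coe_toENNReal (by simpa using hy), neg_neg, ENNReal.exp_log]

theorem exists_lintegral_expNeg_pow_eq {b : ℕ → ℝ≥0∞}
    (h : ∀ᶠ m : ℕ in atTop, ∃ p : PMF (Finset (Fin m)),
      ∀ A, ∑ I with Disjoint I A, p I = b A.card) :
    ∃ ρ : Measure ℝ≥0∞, IsProbabilityMeasure ρ ∧ ∀ k, ∫⁻ x, expNeg x ^ k ∂ρ = b k := by
  obtain ⟨μ, hμ⟩ := exists_moments_unitInterval h
  have hb (k : ℕ) : b k ≠ ⊤ := by
    obtain ⟨m, ⟨p, hp⟩, hm⟩ := (h.and (eventually_ge_atTop k)).exists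
    obtain ⟨A, -, hA⟩ := Finset.exists_subset_card_eq
      (show k ≤ Fintype.card (Fin m) by simpa using hm)
    rw [← hA, ← hp A]
    exact ENNReal.sum_ne_top.2 fun I _ => p.apply_ne_top I
  -- The map `-log` sends `0` to `∞`, so an atom of the moment law at `0` becomes mass at `∞`.
  let T : unitInterval → ℝ≥0∞ := fun x => (-ENNReal.log (ENNReal.ofReal x)).toENNReal
  have hT : Measurable T := by fun_prop
  refine ⟨(μ : Measure unitInterval).map T, Measure.isProbabilityMeasure_map hT.aemeasurable,
    fun k => ?_⟩
  have hc : Continuous fun x : unitInterval => (x : ℝ) ^ k := by fun_prop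
  have hi : Integrable (fun x : unitInterval => (x : ℝ) ^ k) (μ : Measure unitInterval) :=
    (BoundedContinuousFunction.mkOfCompact ⟨_, hc⟩).integrable _
  rw [lintegral_map (measurable_expNeg.pow_const k) hT, ← ENNReal.ofReal_toReal (hb k), ← hμ,
    ofReal_integral_eq_lintegral_ofReal hi (ae_of_all _ fun x => pow_nonneg x.2.1 k)]
  refine lintegral_congr fun x => ?_
  rw [expNeg_toENNReal_neg_log (ENNReal.ofReal_le_one.2 x.2.2), ENNReal.ofReal_pow x.2.1]

/-! ### Uniqueness for Laplace transforms -/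

theorem continuous_expNeg : Continuous expNeg :=
  ENNReal.continuous_exp.comp (continuous_neg.comp continuous_coe_ennreal_ereal)

theorem expNeg_injective : Function.Injective expNeg := fun x y h => by
  simpa using EReal.exp_strictMono.injective h

/-- A law on `[0,∞]` is determined by its Laplace transform at the natural numbers. -/
theorem ext_of_lintegral_expNeg_pow {ρ₁ ρ₂ : Measure ℝ≥0∞} [IsProbabilityMeasure ρ₁]
    [IsProbabilityMeasure ρ₂] (h : ∀ k, ∫⁻ x, expNeg x ^ k ∂ρ₁ = ∫⁻ x, expNeg x ^ k ∂ρ₂) :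
    ρ₁ = ρ₂ := by
  have hne (x : ℝ≥0∞) : expNeg x ≠ ⊤ := ((expNeg_le_one x).trans_lt ENNReal.one_lt_top).ne
  have hc : Continuous fun x => (expNeg x).toReal :=
    ENNReal.continuousOn_toReal.comp_continuous continuous_expNeg hne
  let f : BoundedContinuousFunction ℝ≥0∞ ℝ := BoundedContinuousFunction.mkOfCompact ⟨_, hc⟩
  have hf (k : ℕ) (ρ : Measure ℝ≥0∞) [IsProbabilityMeasure ρ] :
      ∫ x, (f ^ k) x ∂ρ = (∫⁻ x, expNeg x ^ k ∂ρ).toReal := by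
    rw [← integral_toReal (measurable_expNeg.pow_const k).aemeasurable
      (ae_of_all _ fun x => (ENNReal.pow_ne_top (hne x)).lt_top)]
    simp [f]
  -- Polynomials in `e^{-x}` separate the points of `[0,∞]`, and their integrals are combinations of
  -- the given moments.
  let A : StarSubalgebra ℝ (BoundedContinuousFunction ℝ≥0∞ ℝ) :=
    { (Polynomial.aeval f).range with
      star_mem' := fun {g} hg => by
        have : star g = g := by ext; simp
        rwa [this] }
  refine ext_of_forall_mem_subalgebra_integral_eq_of_polish (𝕜 := ℝ) (A := A) ?_ ?_
  · intro x y hxy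
    refine ⟨_, ⟨_, ⟨f, ⟨Polynomial.X, by simp⟩, rfl⟩, rfl⟩, ?_⟩
    change (expNeg x).toReal ≠ (expNeg y).toReal
    rw [Ne, ENNReal.toReal_eq_toReal_iff' (hne x) (hne y)]
    exact fun h => hxy (expNeg_injective h)
  · rintro _ ⟨q, rfl⟩
    change ∫ x, (Polynomial.aeval f q) x ∂ρ₁ = ∫ x, (Polynomial.aeval f q) x ∂ρ₂
    induction q using Polynomial.induction_on' with
    | add q r hq hr =>
      simp only [map_add, BoundedContinuousFunction.coe_add, Pi.add_apply]
      rw [integral_add (BoundedContinuousFunction.integrable _ _)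
          (BoundedContinuousFunction.integrable _ _), hq, hr,
        integral_add (BoundedContinuousFunction.integrable _ _)
          (BoundedContinuousFunction.integrable _ _)]
    | monomial k a =>
      simp only [Polynomial.aeval_monomial, ← Algebra.smul_def,
        BoundedContinuousFunction.coe_smul, integral_const_mul, smul_eq_mul, hf, h]

/-! ### Infinite divisibility and narrow-sense laws -/

theorem lintegral_expNeg_pow_map_sum {n : ℕ} (ρ : Measure ℝ≥0∞) [IsProbabilityMeasure ρ] (k : ℕ) :
    ∫⁻ x, expNeg x ^ k ∂((Measure.pi fun _ : Fin n => ρ).map fun x => ∑ i, x i) =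
      (∫⁻ x, expNeg x ^ k ∂ρ) ^ n := by
  have hm : Measurable fun x => expNeg x ^ k := measurable_expNeg.pow_const k
  rw [lintegral_map hm (by fun_prop)]
  simp only [expNeg_sum, ← Finset.prod_pow]
  have hind : iIndepFun (fun (i : Fin n) (x : Fin n → ℝ≥0∞) => expNeg (x i) ^ k)
      (Measure.pi fun _ : Fin n => ρ) := iIndepFun_pi fun _ => hm.aemeasurable
  rw [lintegral_prod_eq_prod_lintegral_of_indepFun _ _ hind
    fun i => hm.comp (measurable_pi_apply i)]
  have (i : Fin n) : ∫⁻ x, expNeg (x i) ^ k ∂(Measure.pi fun _ : Fin n => ρ) =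
      ∫⁻ x, expNeg x ^ k ∂ρ :=
    (measurePreserving_eval (fun _ : Fin n => ρ) i).lintegral_comp hm
  simp [this]

/-- For `β > 0` this is `n (β ^ (1/n) - 1) → log β`. For `β = 0` the exponent is `-n` once `n ≥ 1`.
-/
theorem tendsto_exp_neg_mul_one_sub_rpow_inv {β : ℝ} (hβ : 0 ≤ β) :
    Tendsto (fun n : ℕ => Real.exp (-(n * (1 - β ^ (n : ℝ)⁻¹)))) atTop (𝓝 β) := by
  rcases hβ.eq_or_lt with rfl | hpos
  · refine (Real.tendsto_exp_neg_atTop_nhds_zero.comp tendsto_natCast_atTop_atTop).congr' ?_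
    filter_upwards [eventually_ge_atTop 1] with n hn
    have : (n : ℝ)⁻¹ ≠ 0 := by positivity
    simp [Real.zero_rpow this]
  · have h := (tendsto_rpow_sub_one_log hpos).comp
      (tendsto_inv_atTop_nhdsGT_zero.comp tendsto_natCast_atTop_atTop)
    have := (Real.continuous_exp.tendsto _).comp h
    rw [Real.exp_log hpos] at this
    refine this.congr fun n => ?_
    simp only [Function.comp_apply, inv_inv]
    congr 1
    ring

section Model

variable {Ω : Type*} [MeasurableSpace Ω] {P : Measure Ω} {X : ℕ → Ω → ℝ≥0∞} {E : ℕ → Ω → ℝ}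

namespace IsModel

theorem laplace_le_one (h : IsModel P X E) (k : ℕ) : laplace P (X 0) k ≤ 1 := by
  have := h.prob
  rw [laplace_eq]
  exact (lintegral_mono fun ω => pow_le_one₀ zero_le (expNeg_le_one _)).trans_eq (by simp)

theorem exists_pmf_laplace (h : IsModel P X E) (d : ℕ) :
    ∃ p : PMF (Finset (Fin d)), ∀ A, ∑ I with Disjoint I A, p I = laplace P (X 0) A.card :=
  (h.hasSurvival_hitLaw d).exists_pmf

theorem isInfinitelyDivisible (h : IsModel P X E)
    (hn : ∀ d : ℕ, 2 ≤ d → IsNarrowGeometric (hitLaw P X E d)) :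
    IsInfinitelyDivisible (P.map (X 0)) := by
  intro n hn2
  have := h.prob
  have hX := h.measurable_X 0
  have := Measure.isProbabilityMeasure_map (μ := P) hX.aemeasurable
  have hn0 : (0 : ℝ) ≤ (n : ℝ)⁻¹ := by positivity
  obtain ⟨ρ, hρ, hρb⟩ := exists_lintegral_expNeg_pow_eq
    (b := fun k => laplace P (X 0) k ^ (n : ℝ)⁻¹) (by
      filter_upwards [eventually_ge_atTop 2] with m hm
      obtain ⟨p, hp, -⟩ := isNarrowGeometric_iff.1 (hn m hm)
      have hg := hp.unique (h.hasSurvival_hitLaw m)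
      -- Taking `n`-th roots of the shock parameters keeps them in `[0,1]` and takes the `n`-th root
      -- of every product, so `β ^ (1/n)` again comes from random subsets.
      obtain ⟨q, hq⟩ := (hasSurvival_map_shockMin fun I =>
        (⟨(p I : ℝ) ^ (n : ℝ)⁻¹, Real.rpow_nonneg (p I).2.1 _,
          Real.rpow_le_one (p I).2.1 (p I).2.2 hn0⟩ : unitInterval)).exists_pmf
      refine ⟨q, fun A => ?_⟩
      rw [hq, ← congrFun hg A, ← ENNReal.prod_rpow_of_nonneg hn0]
      refine Finset.prod_congr rfl fun I _ => ?_
      rw [ENNReal.ofReal_rpow_of_nonneg (p I).2.1 hn0])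
  refine ⟨ρ, hρ, ?_⟩
  have := Measure.isProbabilityMeasure_map (μ := Measure.pi fun _ : Fin n => ρ)
    (f := fun x => ∑ i, x i) (by fun_prop)
  refine ext_of_lintegral_expNeg_pow fun k => ?_
  rw [lintegral_expNeg_pow_map_sum, hρb, ← laplace_eq_map P hX,
    ENNReal.rpow_inv_natCast_pow (by omega)]

theorem exists_pmf_rpow_inv (h : IsModel P X E) (hX : IsInfinitelyDivisible (P.map (X 0))) (d : ℕ)
    {n : ℕ} (hn : 2 ≤ n) : ∃ p : PMF (Finset (Fin d)),
      ∀ A, ∑ I with Disjoint I A, (p I).toReal = (laplace P (X 0) A.card).toReal ^ (n : ℝ)⁻¹ := by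
  obtain ⟨ρ, hρ, hsum⟩ := hX n hn
  have hpow (k : ℕ) : (∫⁻ x, expNeg x ^ k ∂ρ) ^ n = laplace P (X 0) k := by
    rw [← lintegral_expNeg_pow_map_sum, hsum, laplace_eq_map P (h.measurable_X 0)]
  -- The convolution root is not concentrated at `0`, so it drives a model of its own, whose first
  -- trial supplies the random subset.
  have hpos : 0 < ρ {x | 0 < x} := by
    rw [← lintegral_expNeg_lt_one, ← not_le]
    intro h1
    have := hpow 1
    simp only [pow_one] at this
    exact absurd h.laplace_one_lt_one (not_lt.2 (this ▸ one_le_pow₀ h1))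
  obtain ⟨Ω', _, P', X', E', h', rfl⟩ := exists_isModel ρ hpos
  obtain ⟨p, hp⟩ := h'.exists_pmf_laplace d
  refine ⟨p, fun A => ?_⟩
  rw [← ENNReal.toReal_sum fun I _ => p.apply_ne_top I, hp, ← hpow,
    ← laplace_eq_map P' (h'.measurable_X 0), ENNReal.toReal_pow,
    Real.pow_rpow_inv_natCast ENNReal.toReal_nonneg (by omega)]

theorem isNarrowGeometric (h : IsModel P X E) (hX : IsInfinitelyDivisible (P.map (X 0))) (d : ℕ) :
    IsNarrowGeometric (hitLaw P X E d) := by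
  -- The index is shifted by `2` because roots are provided only for `n ≥ 2`.
  choose q hq using fun n : ℕ => h.exists_pmf_rpow_inv hX d (n := n + 2) (by omega)
  let p (n : ℕ) (I : {I : Finset (Fin d) // I.Nonempty}) : unitInterval :=
    ⟨Real.exp (-((n + 2 : ℕ) * (q n I).toReal)), (Real.exp_pos _).le, by
      rw [Real.exp_le_one_iff, neg_nonpos]
      positivity⟩
  have hp (n : ℕ) (A : Finset (Fin d)) : ∏ I with ¬ Disjoint I.1 A, (p n I : ℝ) = Real.exp
      (-((n + 2 : ℕ) * (1 - (laplace P (X 0) A.card).toReal ^ ((n + 2 : ℕ) : ℝ)⁻¹))) := by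
    have htot : ∑ I, (q n I).toReal = 1 := by
      rw [← ENNReal.toReal_sum fun I _ => (q n).apply_ne_top I,
        ← tsum_fintype (L := .unconditional _), (q n).tsum_coe, ENNReal.toReal_one]
    have hsplit := Finset.sum_filter_add_sum_filter_not Finset.univ
      (fun I : Finset (Fin d) => Disjoint I A) fun I => (q n I).toReal
    -- The outcome `∅` has no corresponding shock, but it meets no `A` and so drops out of the sum.
    have hsub : ∑ I : {I : Finset (Fin d) // I.Nonempty} with ¬ Disjoint I.1 A, (q n I).toReal =
        ∑ I with ¬ Disjoint I A, (q n I).toReal := by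
      refine Finset.sum_bij (fun I _ => I.1) (by simp) (fun _ _ _ _ => Subtype.ext) ?_ (by simp)
      intro I hI
      have hI' : ¬ Disjoint I A := by simpa using hI
      have hne : I.Nonempty := Finset.nonempty_iff_ne_empty.2 fun h0 => hI' (by simp [h0])
      exact ⟨⟨I, hne⟩, by simpa using hI', rfl⟩
    simp only [p]
    rw [← Real.exp_sum, Finset.sum_neg_distrib, ← Finset.mul_sum, hsub, ← hq, ← htot, ← hsplit,
      add_sub_cancel_left]
  -- The cube of shock parameters is compact, so they have a limit along an ultrafilter. Parameters
  -- equal to `0` may occur there, which covers `β_|A| = 0`.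
  obtain ⟨r, -, hr⟩ := isCompact_univ.ultrafilter_le_nhds
    (Ultrafilter.map p (hyperfilter ℕ)) (by simp)
  have hr : Tendsto p (hyperfilter ℕ) (𝓝 r) := hr
  have hprod (A : Finset (Fin d)) : ∏ I with ¬ Disjoint I.1 A, ENNReal.ofReal (r I) =
      laplace P (X 0) A.card := by
    have h1 : Tendsto (fun n => ∏ I with ¬ Disjoint I.1 A, (p n I : ℝ)) (hyperfilter ℕ)
        (𝓝 (∏ I with ¬ Disjoint I.1 A, (r I : ℝ))) :=
      tendsto_finsetProd _ fun I _ =>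
        (continuous_subtype_val.tendsto _).comp (tendsto_pi_nhds.1 hr I)
    simp only [hp] at h1
    have h2 := ((tendsto_exp_neg_mul_one_sub_rpow_inv
      (ENNReal.toReal_nonneg (a := laplace P (X 0) A.card))).comp
        (tendsto_add_atTop_nat 2)).mono_left Nat.hyperfilter_le_atTop
    rw [← ENNReal.ofReal_prod_of_nonneg fun I _ => (r I).2.1, tendsto_nhds_unique h1 h2,
      ENNReal.ofReal_toReal ((h.laplace_le_one _).trans_lt ENNReal.one_lt_top).ne]
  refine isNarrowGeometric_iff.2 ⟨r, ?_, fun k => ?_⟩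
  · simpa only [hprod] using h.hasSurvival_hitLaw d
  · simpa only [hprod, Finset.card_singleton] using h.laplace_one_lt_one

theorem isWideGeometric (h : IsModel P X E) (d : ℕ) : IsWideGeometric (hitLaw P X E d) :=
  isWideGeometric_iff.2 ⟨_, h.hasSurvival_hitLaw d, fun _ => by
    simpa only [Finset.card_singleton] using h.laplace_one_lt_one⟩

end IsModel

end Model

/-! ### Exchangeable sequences -/

theorem HasSurvival.isExchangeable {d : ℕ} {μ : Measure (Fin d → ℕ∞)} {b : ℕ → ℝ≥0∞}
    (h : HasSurvival μ fun A => b A.card) : IsExchangeable μ := by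
  intro σ
  have := h.1
  have hm : Measurable fun (x : Fin d → ℕ∞) i => x (σ i) := Measurable.of_discrete
  refine HasSurvival.ext (g := fun A => b A.card)
    ⟨Measure.isProbabilityMeasure_map hm.aemeasurable, fun n N hN => ?_⟩ h
  rw [Measure.map_apply hm MeasurableSet.of_discrete]
  have hset : (fun (x : Fin d → ℕ∞) i => x (σ i)) ⁻¹' {x | ∀ i, (n i : ℕ∞) < x i} =
      {x | ∀ i, (n (σ.symm i) : ℕ∞) < x i} := by
    ext x
    exact ⟨fun H i => by simpa using H (σ.symm i), fun H i => by simpa using H (σ i)⟩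
  rw [hset, h.2 (fun i => n (σ.symm i)) N fun i => hN _]
  refine Finset.prod_congr rfl fun j _ => congrArg b ?_
  exact Finset.card_equiv σ.symm (by simp)

theorem IsExchangeable.measure_one_lt_congr {d : ℕ} {μ : Measure (Fin d → ℕ∞)}
    (h : IsExchangeable μ) {A B : Finset (Fin d)} (hAB : A.card = B.card) :
    μ {x | ∀ i ∈ A, 1 < x i} = μ {x | ∀ i ∈ B, 1 < x i} := by
  -- A bijection from `A` to `B` extends to a permutation of all components.
  let σ : Equiv.Perm (Fin d) := (Finset.equivOfCardEq hAB).extendSubtype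
  have hσ (i : Fin d) : i ∈ A ↔ σ i ∈ B :=
    ⟨fun hi => Equiv.extendSubtype_mem _ i hi, fun hi => by
      by_contra hA
      exact Equiv.extendSubtype_not_mem _ i hA hi⟩
  have hm : Measurable fun (x : Fin d → ℕ∞) i => x (σ i) := Measurable.of_discrete
  nth_rewrite 1 [← h σ]
  rw [Measure.map_apply hm MeasurableSet.of_discrete]
  congr 1
  ext x
  refine ⟨fun H i hi => ?_, fun H i hi => H _ ((hσ i).1 hi)⟩
  have := H (σ.symm i) ((hσ _).2 (by simpa using hi))
  simpa using this

/-- An infinite exchangeable sequence with wide-sense geometric blocks is, in law, the sequence of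
the first passage times of the random walk model. -/
theorem exists_isModel_hitLaw_eq {ν : Measure (ℕ → ℕ∞)}
    (hν : ∀ m : ℕ, 1 ≤ m → IsExchangeable (initialBlock ν m) ∧
      IsWideGeometric (initialBlock ν m)) :
    ∃ (Ω : Type) (_ : MeasurableSpace Ω) (P : Measure Ω) (X : ℕ → Ω → ℝ≥0∞) (E : ℕ → Ω → ℝ),
      IsModel P X E ∧ ∀ m : ℕ, 1 ≤ m → hitLaw P X E m = initialBlock ν m := by
  -- Defined from the whole sequence, `b` does not depend on the block length `m`, so one moment
  -- sequence serves all blocks.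
  let b : ℕ → ℝ≥0∞ := fun k => ν {x | ∀ i < k, 1 < x i}
  have hb (m : ℕ) (hm : 1 ≤ m) (A : Finset (Fin m)) :
      initialBlock ν m {x | ∀ i ∈ A, 1 < x i} = b A.card := by
    have hA : A.card ≤ m := (Finset.card_le_univ A).trans_eq (Fintype.card_fin m)
    rw [(hν m hm).1.measure_one_lt_congr (B := {i | (i : ℕ) < A.card}) (by
      rw [Fin.card_filter_val_lt, min_eq_right hA]), initialBlock,
      Measure.map_apply (measurable_pi_lambda _ fun i => measurable_pi_apply _)
        MeasurableSet.of_discrete]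
    congr 1
    ext x
    simp only [Set.mem_preimage, Set.mem_ofPred_eq, Finset.mem_filter, Finset.mem_univ, true_and]
    exact ⟨fun H i hi => H ⟨i, hi.trans_le hA⟩ hi, fun H i hi => H i hi⟩
  have hs (m : ℕ) (hm : 1 ≤ m) :
      HasSurvival (initialBlock ν m) (fun A => b A.card) ∧ b 1 < 1 := by
    obtain ⟨g, hg, hlt⟩ := isWideGeometric_iff.1 (hν m hm).2
    have : g = fun A => b A.card := funext fun A => by rw [← hb m hm, hg.measure_one_lt]
    subst this
    exact ⟨hg, by simpa only [Finset.card_singleton] using hlt ⟨0, hm⟩⟩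
  obtain ⟨ρ, hρ, hρb⟩ := exists_lintegral_expNeg_pow_eq (b := b) (by
    filter_upwards [eventually_ge_atTop 1] with m hm
    exact (hs m hm).1.exists_pmf)
  have hpos : 0 < ρ {x | 0 < x} := by
    have h1 := hρb 1
    simp only [pow_one] at h1
    rw [← lintegral_expNeg_lt_one, h1]
    exact (hs 1 le_rfl).2
  obtain ⟨Ω, _, P, X, E, h, rfl⟩ := exists_isModel ρ hpos
  refine ⟨Ω, _, P, X, E, h, fun m hm => (h.hasSurvival_hitLaw m).ext ?_⟩
  have hl (k : ℕ) : laplace P (X 0) k = b k := by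
    rw [laplace_eq_map P (h.measurable_X 0), hρb]
  simpa only [hl] using (hs m hm).1

end MultiGeo

open MultiGeo

theorem theorem13 :
    (∀ {Ω : Type*} [MeasurableSpace Ω] (P : Measure Ω) (X : ℕ → Ω → ℝ≥0∞) (E : ℕ → Ω → ℝ),
      IsModel P X E →
        -- the first passage times are almost surely finite
        (∀ᵐ ω ∂P, ∀ k, hit X E k ω ≠ ⊤) ∧
        -- every finite block is exchangeable and wide-sense geometric
        (∀ d : ℕ, 1 ≤ d →
          IsExchangeable (hitLaw P X E d) ∧
          IsWideGeometric (hitLaw P X E d) ∧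
          ∀ n : Fin d → ℕ,
            P {ω | ∀ i, (n i : ℕ∞) < hit X E i ω} =
              ∏ k ∈ Finset.Icc 1 d,
                laplace P (X 0) k ^ (orderStat n (d - k + 1) - orderStat n (d - k))) ∧
        -- the blocks are narrow-sense geometric precisely when `X_1` is infinitely divisible
        (IsInfinitelyDivisible (P.map (X 0)) ↔
          ∀ d : ℕ, 2 ≤ d → IsNarrowGeometric (hitLaw P X E d))) ∧
    -- every extendible wide-sense geometric law comes from the model
    (∀ (d : ℕ) (μ : Measure (Fin d → ℕ∞)), 1 ≤ d →
      IsExtendible (fun _ => IsWideGeometric) μ →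
        ∃ (Ω : Type) (_ : MeasurableSpace Ω) (P : Measure Ω) (X : ℕ → Ω → ℝ≥0∞) (E : ℕ → Ω → ℝ),
          IsModel P X E ∧ hitLaw P X E d = μ) ∧
    -- every extendible narrow-sense geometric law comes from the model with infinitely divisible
    -- increments
    (∀ (d : ℕ) (μ : Measure (Fin d → ℕ∞)), 1 ≤ d →
      IsExtendible (fun _ => IsNarrowGeometric) μ →
        ∃ (Ω : Type) (_ : MeasurableSpace Ω) (P : Measure Ω) (X : ℕ → Ω → ℝ≥0∞) (E : ℕ → Ω → ℝ),
          IsModel P X E ∧ IsInfinitelyDivisible (P.map (X 0)) ∧ hitLaw P X E d = μ) := by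
  refine ⟨fun P X E h => ⟨h.ae_hit_ne_top, fun d _ => ⟨(h.hasSurvival_hitLaw d).isExchangeable,
    h.isWideGeometric d, fun n => ?_⟩, fun hX d _ => h.isNarrowGeometric hX d,
    h.isInfinitelyDivisible⟩, ?_, ?_⟩
  · have hN (i : Fin d) : n i ≤ ∑ i, n i :=
      Finset.single_le_sum (f := n) (fun _ _ => Nat.zero_le _) (Finset.mem_univ i)
    have := h.prob
    rw [h.measure_forall_lt_hit n _ hN,
      prod_card_eq_prod_orderStat _ (by simp [laplace_eq]) n _ hN]
  · rintro d μ hd ⟨ν, -, hν, rfl⟩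
    obtain ⟨Ω, _, P, X, E, h, heq⟩ := exists_isModel_hitLaw_eq hν
    exact ⟨Ω, _, P, X, E, h, heq d hd⟩
  · rintro d μ hd ⟨ν, -, hν, rfl⟩
    obtain ⟨Ω, _, P, X, E, h, heq⟩ := exists_isModel_hitLaw_eq fun m hm =>
      ⟨(hν m hm).1, (hν m hm).2.isWideGeometric⟩
    refine ⟨Ω, _, P, X, E, h, h.isInfinitelyDivisible fun m hm => ?_, heq d hd⟩
    rw [heq m (by omega)]
    exact (hν m (by omega)).2
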